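/- Let $c_0$ be the Banach algebra of all complex sequences $x=(x_n)_{n\ge 0}$ with $x_n\to 0$, endowed with the norm $\|x\|=\sup_n|x_n|$ and the coordinatewise product. For a sequence $w=(w_n)_{n\ge 1}$ of nonzero complex numbers (a weight), let $B_w(x_0,x_1,x_2,\dots)=(w_1x_1,w_2x_2,\dots)$. **Theorem.** There exists a weight $w=(w_n)_{n\ge 1}$ such that $B_w$ is a bounded operator on $c_0$ and supports a frequently hypercyclic algebra: there is a (not necessarily unital) complex subalgebra $A\neq\{0\}$ of $c_0$ such that, for every $x\in A\setminus\{0\}$ and every non-empty open set $U\subset c_0$, the set $\{n\ge 1: B_w^n x\in U\}$ has positive lower density, that is, $$\liminf_{N\to\infty}\frac{\#\{1\le n\le N: B_w^n x\in U\}}{N}>0.$$ -/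

import Mathlib

open Filter
open scoped ZeroAtInfty

/-- The lower density `liminf_N #{n ∈ A : 1 ≤ n ≤ N} / N` of a set `A` of positive integers
(the element `0`, if it belongs to `A`, is not counted). -/
noncomputable def lowerDensity (A : Set ℕ) : ℝ :=
  liminf (fun N : ℕ => ((A ∩ Set.Icc 1 N).ncard : ℝ) / (N : ℝ)) atTop

/-- `x` is a frequently hypercyclic vector for `T`: for every non-empty open set `U`, the set of
times `n` with `T ^ n x ∈ U` has positive lower density. -/
def IsFrequentlyHypercyclicVector {X : Type*} [AddCommMonoid X] [Module ℂ X] [TopologicalSpace X]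
    (T : X →L[ℂ] X) (x : X) : Prop :=
  ∀ U : Set X, IsOpen U → U.Nonempty → 0 < lowerDensity {n : ℕ | (T ^ n) x ∈ U}

/-- `T` supports a frequently hypercyclic algebra: there is a (not necessarily unital) complex
subalgebra, not reduced to `0`, all of whose non-zero elements are frequently hypercyclic
vectors for `T`. -/
def SupportsFrequentlyHypercyclicAlgebra {X : Type*} [NonUnitalRing X] [Module ℂ X]
    [TopologicalSpace X] (T : X →L[ℂ] X) : Prop :=
  ∃ A : NonUnitalSubalgebra ℂ X, (∃ x ∈ A, x ≠ 0) ∧ ∀ x ∈ A, x ≠ 0 → IsFrequentlyHypercyclicVector T x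

/-- The weighted backward shift `(x₀, x₁, x₂, …) ↦ (w₁ x₁, w₂ x₂, …)` on all complex sequences.
The value `w 0` plays no role. -/
def weightedShiftSeq (w : ℕ → ℂ) : (ℕ → ℂ) →ₗ[ℂ] (ℕ → ℂ) where
  toFun x n := w (n + 1) * x (n + 1)
  map_add' x y := by
    funext n
    simp [mul_add]
  map_smul' c x := by
    funext n
    simp [mul_left_comm]

/-- `T` is the weighted backward shift with weight `w` as a bounded operator on `c₀`. Here `c₀` is
`C₀(ℕ, ℂ)`: complex sequences that tend to zero, with the supremum norm and the coordinatewise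
product. -/
def IsWeightedBackwardShift (w : ℕ → ℂ) (T : C₀(ℕ, ℂ) →L[ℂ] C₀(ℕ, ℂ)) : Prop :=
  ∀ x : C₀(ℕ, ℂ), (T x : ℕ → ℂ) = weightedShiftSeq w x

open Topology

/-! ### The weighted shift with weight `(n + 1) / n` -/

/-! With the weight `(n + 1) / n`, the `n`-th iterate multiplies coordinate `n + s` by `(n + s + 1)
/ (s + 1)`. A nonzero polynomial without constant term is `X ^ m * Q` with `a = Q(0) ≠ 0`. Hence, if
`x → 0` and `(q + 1) * x q ^ m` follows a prescribed bounded pattern, the polynomial in `x` follows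
`a` times that pattern up to `o(1)`: only the lowest exponent matters.

The generator `x` serves all exponents at once. On the block `[4 ^ j, 4 ^ (j + 1))`, the valuation
of `j` selects an exponent `m`, a finite word and a period `N`, and `x ^ m` is the `N`-periodic word
divided by `q + 1`. A logarithmic cutoff forces `x → 0` yet is eventually inactive for each fixed
choice (`eventually_div_le_cutoff_pow`). At multiples of `N` in the first part of such a block the
iterate is close to the target (`isFrequentlyHypercyclicVector_of_eval`); these times have positive
lower density (`lowerDensity_pos_of_blocks`) since suitable `j` recur with bounded gaps. -/

lemma norm_apply_le_norm (x : C₀(ℕ, ℂ)) (n : ℕ) : ‖x n‖ ≤ ‖x‖ := by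
  rw [← ZeroAtInftyContinuousMap.norm_toBCF_eq_norm]
  exact x.toBCF.norm_coe_le_norm n

lemma norm_le_of_forall_apply_le {x : C₀(ℕ, ℂ)} {c : ℝ} (hc : 0 ≤ c) (h : ∀ n, ‖x n‖ ≤ c) :
    ‖x‖ ≤ c := by
  rw [← ZeroAtInftyContinuousMap.norm_toBCF_eq_norm]
  exact (BoundedContinuousFunction.norm_le hc).2 h

lemma tendsto_apply_atTop (x : C₀(ℕ, ℂ)) : Tendsto x atTop (𝓝 0) := by
  have h := x.zero_at_infty'
  rwa [cocompact_eq_cofinite, Nat.cofinite_eq_atTop] at h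

/-- The element of `c₀` given by a sequence tending to zero. -/
def zeroAtInftyOfTendsto (f : ℕ → ℂ) (hf : Tendsto f atTop (𝓝 0)) : C₀(ℕ, ℂ) where
  toFun := f
  continuous_toFun := continuous_of_discreteTopology
  zero_at_infty' := by rwa [cocompact_eq_cofinite, Nat.cofinite_eq_atTop]

@[simp]
lemma zeroAtInftyOfTendsto_apply (f : ℕ → ℂ) (hf : Tendsto f atTop (𝓝 0)) (n : ℕ) :
    zeroAtInftyOfTendsto f hf n = f n := rfl

/-- The weight `w n = (n + 1) / n`, whose partial products are `n + 1`. -/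
noncomputable def harmonicWeight (n : ℕ) : ℂ := (n + 1) / n

lemma norm_harmonicWeight_succ_le (n : ℕ) : ‖harmonicWeight (n + 1)‖ ≤ 2 := by
  have h : harmonicWeight (n + 1) = ((((n : ℝ) + 1 + 1) / (n + 1) : ℝ) : ℂ) := by
    simp [harmonicWeight]
  have hn : (0 : ℝ) ≤ n := n.cast_nonneg
  rw [h, Complex.norm_real, Real.norm_of_nonneg (by positivity), div_le_iff₀ (by positivity)]
  linarith

lemma norm_harmonicWeight_mul_le (x : C₀(ℕ, ℂ)) (n : ℕ) :
    ‖harmonicWeight (n + 1) * x (n + 1)‖ ≤ 2 * ‖x (n + 1)‖ := by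
  rw [norm_mul]
  exact mul_le_mul_of_nonneg_right (norm_harmonicWeight_succ_le n) (norm_nonneg _)

/-- The weighted backward shift with weight `(n + 1) / n`, as a bounded operator on `c₀`. -/
noncomputable def harmonicShift : C₀(ℕ, ℂ) →L[ℂ] C₀(ℕ, ℂ) :=
  LinearMap.mkContinuous
    { toFun := fun x => zeroAtInftyOfTendsto (fun n => harmonicWeight (n + 1) * x (n + 1)) <| by
        refine squeeze_zero_norm (norm_harmonicWeight_mul_le x) ?_
        simpa using
          (((tendsto_apply_atTop x).comp (tendsto_add_atTop_nat 1)).norm.const_mul (2 : ℝ))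
      map_add' := fun x y => by ext n; simp [mul_add]
      map_smul' := fun c x => by ext n; simp [mul_left_comm] } 2 <| fun x =>
    norm_le_of_forall_apply_le (by positivity) fun n =>
      (norm_harmonicWeight_mul_le x n).trans (by gcongr; exact norm_apply_le_norm x _)

lemma harmonicShift_apply (x : C₀(ℕ, ℂ)) (n : ℕ) :
    harmonicShift x n = harmonicWeight (n + 1) * x (n + 1) := rfl

lemma isWeightedBackwardShift_harmonicShift :
    IsWeightedBackwardShift harmonicWeight harmonicShift := fun _ => rfl

lemma harmonicShift_pow_apply (x : C₀(ℕ, ℂ)) (n s : ℕ) :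
    (harmonicShift ^ n) x s = ((n + s : ℕ) + 1) / (s + 1) * x (n + s) := by
  induction n generalizing s with
  | zero =>
    have : (s : ℂ) + 1 ≠ 0 := Nat.cast_add_one_ne_zero s
    simp [this]
  | succ n ih =>
    have h1 : (s : ℂ) + 1 ≠ 0 := Nat.cast_add_one_ne_zero s
    have h2 : (s : ℂ) + 1 + 1 ≠ 0 := by exact_mod_cast Nat.succ_ne_zero (s + 1)
    rw [pow_succ', mul_apply_eq_comp, harmonicShift_apply, ih, harmonicWeight,
      show n + (s + 1) = n + 1 + s by ring]
    push_cast
    field_simp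

/-! ### Lower density -/

lemma lowerDensity_pos_of_forall_ge {A : Set ℕ} {c : ℝ} (hc : 0 < c) {K₀ : ℕ}
    (h : ∀ K ≥ K₀, c * K ≤ ((A ∩ Set.Icc 1 K).ncard : ℝ)) : 0 < lowerDensity A := by
  refine hc.trans_le (le_liminf_of_le ?_ ?_)
  -- A real `liminf` is meaningful only with a boundedness condition; the quotients are at most `1`.
  · refine IsBoundedUnder.isCoboundedUnder_ge ⟨1, eventually_map.2 (Eventually.of_forall fun K => ?_)⟩
    refine div_le_one_of_le₀ ?_ K.cast_nonneg
    have := Set.ncard_le_ncard (Set.inter_subset_right (s := A)) (Set.finite_Icc 1 K)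
    rw [Set.ncard_eq_toFinset_card' (Set.Icc 1 K)] at this
    simp only [Set.toFinset_Icc, Nat.card_Icc, add_tsub_cancel_right] at this
    exact_mod_cast this
  · filter_upwards [eventually_ge_atTop (max K₀ 1)] with K hK
    have : (0 : ℝ) < K := by exact_mod_cast (le_max_right K₀ 1).trans hK
    rw [le_div_iff₀ this]
    exact h K ((le_max_left _ _).trans hK)

/-- Odd multiples of `2 ^ i` recur with bounded gaps; the witness is the midpoint following the
first multiple of `2 ^ (i + 1)` beyond `j`. -/
lemma exists_padicValNat_two_eq (i j : ℕ) :
    ∃ j', j ≤ j' ∧ j' ≤ j + 2 ^ (i + 2) ∧ padicValNat 2 j' = i := by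
  refine ⟨2 ^ i * (2 * (j / 2 ^ (i + 1) + 1) + 1), ?_, ?_, ?_⟩
  · have := Nat.lt_div_mul_add (a := j) (b := 2 ^ (i + 1)) (by positivity)
    rw [pow_succ] at this ⊢
    nlinarith [Nat.two_pow_pos i]
  · have := Nat.div_mul_le_self j (2 ^ (i + 1))
    rw [show 2 ^ (i + 2) = 2 ^ i * 4 by ring]
    rw [pow_succ] at this ⊢
    nlinarith [Nat.two_pow_pos i]
  · rw [padicValNat.mul (by positivity) (by positivity), padicValNat.prime_pow,
      padicValNat.eq_zero_of_not_dvd (by omega), add_zero]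

/-- The multiples of `N` in the intervals `[4 ^ j, 2 * 4 ^ j - N]`, for the `j ≥ J` whose `2`-adic
valuation is `i`, have positive lower density. -/
lemma lowerDensity_pos_of_blocks {A : Set ℕ} {i N J : ℕ} (hN : 0 < N)
    (h : ∀ j n, J ≤ j → padicValNat 2 j = i → N ∣ n → 4 ^ j ≤ n → n + N ≤ 2 * 4 ^ j → n ∈ A) :
    0 < lowerDensity A := by
  set L := 2 ^ (i + 2) with hL
  obtain ⟨J', hJ'⟩ : ∃ J', J ≤ J' ∧ ∀ j ≥ J', 4 * N ≤ 4 ^ j := by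
    refine ⟨max J (4 * N), le_max_left _ _, fun j hj => ?_⟩
    exact ((le_max_right J (4 * N)).trans hj).trans (Nat.lt_pow_self (by norm_num)).le
  refine lowerDensity_pos_of_forall_ge (c := 1 / (4 * N * 4 ^ (L + 2)))
    (K₀ := 4 ^ (J' + L + 1)) (by positivity) fun K hK => ?_
  set t := Nat.log 4 K with ht
  have hK0 : K ≠ 0 := by
    have : 0 < 4 ^ (J' + L + 1) := by positivity
    omega
  have hJt : J' + L + 1 ≤ t := Nat.le_log_of_pow_le (by norm_num) hK
  have htK : 4 ^ t ≤ K := Nat.pow_log_le_self 4 hK0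
  have hKt : K < 4 ^ (t + 1) := Nat.lt_pow_succ_log_self (by norm_num) K
  -- This window ends at `t - 1`: the block start `4 ^ j` is at most `K / 4` and at least `K / 4 ^
  -- (L + 2)`.
  obtain ⟨j, hj1, hj2, hji⟩ := exists_padicValNat_two_eq i (t - 1 - L)
  have hjJ : J' ≤ j := by omega
  have hjt : j + 1 ≤ t := by omega
  have h4N := hJ'.2 j hjJ
  have h4j : 4 * 4 ^ j ≤ K := by
    calc 4 * 4 ^ j = 4 ^ (j + 1) := by ring
      _ ≤ 4 ^ t := Nat.pow_le_pow_right (by norm_num) hjt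
      _ ≤ K := htK
  have hKj : K ≤ 4 ^ j * 4 ^ (L + 2) := by
    rw [← pow_add]
    exact hKt.le.trans (Nat.pow_le_pow_right (by norm_num) (by omega))
  set a := 4 ^ j / N with ha
  have ha4 : 4 ≤ a := (Nat.le_div_iff_mul_le hN).2 (by linarith)
  have ha1 : a * N ≤ 4 ^ j := Nat.div_mul_le_self _ _
  have ha2 : 4 ^ j < a * N + N := Nat.lt_div_mul_add hN
  have hfin : (A ∩ Set.Icc 1 K).Finite := (Set.finite_Icc 1 K).inter_of_right A
  have hsub : (Finset.Icc (a + 1) (2 * a - 1)).image (· * N) ⊆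
      hfin.toFinset := by
    intro n hn
    obtain ⟨b, hb, rfl⟩ := Finset.mem_image.1 hn
    rw [Finset.mem_Icc] at hb
    have hb1 : (a + 1) * N ≤ b * N := Nat.mul_le_mul_right _ hb.1
    have hb2 : (b + 1) * N ≤ (2 * a) * N := Nat.mul_le_mul_right _ (by omega)
    simp only [Set.Finite.mem_toFinset, Set.mem_inter_iff, Set.mem_Icc]
    refine ⟨h j _ (hJ'.1.trans hjJ) hji (Dvd.intro_left b rfl) (by nlinarith) (by nlinarith), ?_, ?_⟩
    · nlinarith
    · nlinarith
  have hcard := Finset.card_le_card hsub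
  rw [Finset.card_image_of_injective _ (fun b c hbc => Nat.eq_of_mul_eq_mul_right hN hbc), Nat.card_Icc,
    ← Set.ncard_eq_toFinset_card _ hfin] at hcard
  have h4 : 4 ^ j ≤ 4 * N * (A ∩ Set.Icc 1 K).ncard := by
    have : a + 1 ≤ 4 * (A ∩ Set.Icc 1 K).ncard := by omega
    nlinarith
  have h5 : K ≤ 4 * N * (A ∩ Set.Icc 1 K).ncard * 4 ^ (L + 2) := hKj.trans (by gcongr)
  rw [one_div, inv_mul_le_iff₀ (by positivity)]
  calc (K : ℝ) ≤ 4 * N * (A ∩ Set.Icc 1 K).ncard * 4 ^ (L + 2) := by exact_mod_cast h5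
    _ = _ := by ring

/-! ### The generator of the algebra -/

/-- A slowly decreasing sequence of positive real numbers bounded by `1`. -/
noncomputable def cutoff (q : ℕ) : ℝ := (Real.log (q + 3))⁻¹

lemma one_le_log_add_three (q : ℕ) : 1 ≤ Real.log (q + 3) := by
  rw [Real.le_log_iff_exp_le (by positivity)]
  have : (0 : ℝ) ≤ q := q.cast_nonneg
  linarith [Real.exp_one_lt_d9]

lemma cutoff_pos (q : ℕ) : 0 < cutoff q :=
  inv_pos.2 (one_pos.trans_le (one_le_log_add_three q))

lemma cutoff_le_one (q : ℕ) : cutoff q ≤ 1 := inv_le_one_of_one_le₀ (one_le_log_add_three q)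

lemma tendsto_natCast_add_three : Tendsto (fun q : ℕ => (q : ℝ) + 3) atTop atTop :=
  tendsto_atTop_add_const_right _ _ tendsto_natCast_atTop_atTop

lemma tendsto_cutoff : Tendsto cutoff atTop (𝓝 0) :=
  tendsto_inv_atTop_zero.comp (Real.tendsto_log_atTop.comp tendsto_natCast_add_three)

/-- Powers of a logarithm grow slower than `q`, so a single cutoff suits every exponent `m`. -/
lemma eventually_div_le_cutoff_pow {M : ℝ} (hM : 0 ≤ M) (m : ℕ) :
    ∀ᶠ q : ℕ in atTop, M / (q + 1) ≤ cutoff q ^ m := by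
  have h : ∀ᶠ x : ℝ in atTop, ‖Real.log x ^ m‖ ≤ (1 / (3 * (M + 1))) * ‖x‖ :=
    (Real.isLittleO_pow_log_id_atTop (n := m)).bound (by positivity)
  filter_upwards [tendsto_natCast_add_three.eventually h] with q hq
  have h1 := one_pos.trans_le (one_le_log_add_three q)
  have hq0 : (0 : ℝ) ≤ q := q.cast_nonneg
  rw [Real.norm_of_nonneg (by positivity), Real.norm_of_nonneg (by positivity), one_div,
    inv_mul_eq_div, le_div_iff₀ (by positivity)] at hq
  rw [cutoff, inv_pow, div_le_iff₀ (by positivity), inv_mul_eq_div, le_div_iff₀ (by positivity)]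
  have : 1 ≤ Real.log (q + 3) ^ m := one_le_pow₀ (one_le_log_add_three q)
  nlinarith

/-- The finitely supported sequence of complex numbers coded by a list of natural numbers. -/
noncomputable def codedSeq (l : List ℕ) (k : ℕ) : ℂ := (l.map (TopologicalSpace.denseSeq ℂ)).getD k 0

lemma codedSeq_of_length_le {l : List ℕ} {k : ℕ} (h : l.length ≤ k) : codedSeq l k = 0 :=
  List.getD_eq_default _ _ (by simpa using h)

lemma exists_norm_codedSeq_le (l : List ℕ) : ∃ M, 0 ≤ M ∧ ∀ k, ‖codedSeq l k‖ ≤ M := by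
  refine ⟨∑ k ∈ Finset.range l.length, ‖codedSeq l k‖, by positivity, fun k => ?_⟩
  rcases lt_or_ge k l.length with hk | hk
  · exact Finset.single_le_sum (f := fun k => ‖codedSeq l k‖) (fun _ _ => norm_nonneg _)
      (Finset.mem_range.2 hk)
  · rw [codedSeq_of_length_le hk, norm_zero]
    positivity

lemma exists_codedSeq_close (z : ℕ → ℂ) (p : ℕ) {δ : ℝ} (hδ : 0 < δ) :
    ∃ l : List ℕ, l.length = p ∧ ∀ k < p, ‖codedSeq l k - z k‖ < δ := by
  have h : ∀ k, ∃ d, ‖TopologicalSpace.denseSeq ℂ d - z k‖ < δ := fun k => by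
    obtain ⟨_, ⟨d, rfl⟩, hd⟩ :=
      Metric.dense_iff.1 (TopologicalSpace.denseRange_denseSeq ℂ) (z k) δ hδ |>.imp fun _ h => h.symm
    exact ⟨d, by simpa [dist_eq_norm] using hd⟩
  choose d hd using h
  refine ⟨List.ofFn fun k : Fin p => d k, by simp, fun k hk => ?_⟩
  simpa [codedSeq, List.getD, hk] using hd k

/-- The data (exponent, coded target, period) attached to the block of index `j`. -/
noncomputable def blockData (j : ℕ) : ℕ × List ℕ × ℕ :=
  Denumerable.ofNat (ℕ × List ℕ × ℕ) (padicValNat 2 j)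

/-- The uncut value of the generator at `q`: for the data `(m, l, N)` of the block of `q`, an
`m`-th root of `codedSeq l (q % N) / (q + 1)`. -/
noncomputable def generatorRoot (q : ℕ) : ℂ :=
  let d := blockData (Nat.log 4 q)
  (codedSeq d.2.1 (q % d.2.2) / (q + 1)) ^ ((d.1 : ℂ)⁻¹)

open Classical in
/-- The sequence generating the algebra. -/
noncomputable def generator (q : ℕ) : ℂ :=
  if ‖generatorRoot q‖ ≤ cutoff q then generatorRoot q else 0

lemma norm_generator_le (q : ℕ) : ‖generator q‖ ≤ cutoff q := by
  unfold generator
  split_ifs with h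
  · exact h
  · simpa using (cutoff_pos q).le

lemma norm_generator_le_one (q : ℕ) : ‖generator q‖ ≤ 1 :=
  (norm_generator_le q).trans (cutoff_le_one q)

lemma tendsto_generator : Tendsto generator atTop (𝓝 0) :=
  squeeze_zero_norm norm_generator_le tendsto_cutoff

section Block

variable {j q m N : ℕ} {l : List ℕ}

lemma generatorRoot_pow (hd : blockData j = (m, l, N)) (hm : m ≠ 0) (h1 : 4 ^ j ≤ q)
    (h2 : q < 4 ^ (j + 1)) : generatorRoot q ^ m = codedSeq l (q % N) / (q + 1) := by
  simp only [generatorRoot, Nat.log_eq_of_pow_le_of_lt_pow h1 h2, hd]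
  exact Complex.cpow_nat_inv_pow _ hm

/-- An upper bound valid whether or not the cutoff acts; it controls the coordinates past the first
period. -/
lemma norm_generator_pow_le (hd : blockData j = (m, l, N)) (hm : m ≠ 0) (h1 : 4 ^ j ≤ q)
    (h2 : q < 4 ^ (j + 1)) : (q + 1) * ‖generator q‖ ^ m ≤ ‖codedSeq l (q % N)‖ := by
  have hq : (0 : ℝ) < q + 1 := by positivity
  unfold generator
  split_ifs with h
  · rw [← norm_pow, generatorRoot_pow hd hm h1 h2, norm_div, mul_div_assoc',
      show ‖(q : ℂ) + 1‖ = q + 1 by exact_mod_cast Complex.norm_natCast (q + 1),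
      mul_div_cancel_left₀ _ hq.ne']
  · simp [hm]

lemma generator_pow_eq (hd : blockData j = (m, l, N)) (hm : m ≠ 0) (h1 : 4 ^ j ≤ q)
    (h2 : q < 4 ^ (j + 1)) (hc : ‖codedSeq l (q % N)‖ / (q + 1) ≤ cutoff q ^ m) :
    (q + 1) * generator q ^ m = codedSeq l (q % N) := by
  have hr := generatorRoot_pow hd hm h1 h2
  have hle : ‖generatorRoot q‖ ≤ cutoff q := by
    refine le_of_pow_le_pow_left₀ hm (cutoff_pos q).le ?_
    rwa [← norm_pow, hr, norm_div,
      show ‖(q : ℂ) + 1‖ = q + 1 by exact_mod_cast Complex.norm_natCast (q + 1)]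
  have : generator q = generatorRoot q := if_pos hle
  rw [this, hr, mul_div_cancel₀ _ (Nat.cast_add_one_ne_zero q)]

end Block

/-! ### Polynomials without constant term -/

lemma exists_eq_X_pow_mul {P : Polynomial ℂ} (hP : P ≠ 0) (h0 : P.eval 0 = 0) :
    ∃ (m : ℕ) (Q : Polynomial ℂ), m ≠ 0 ∧ Q.eval 0 ≠ 0 ∧ P = Polynomial.X ^ m * Q := by
  obtain ⟨Q, hQ, hnd⟩ := P.exists_eq_pow_rootMultiplicity_mul_and_not_dvd hP 0
  refine ⟨_, Q, ((P.rootMultiplicity_pos hP).2 h0).ne', fun h => hnd ?_, by simpa using hQ⟩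
  exact Polynomial.dvd_iff_isRoot.2 h

lemma exists_norm_eval_le (Q : Polynomial ℂ) :
    ∃ C, 0 < C ∧ ∀ x : ℂ, ‖x‖ ≤ 1 → ‖Q.eval x‖ ≤ C := by
  obtain ⟨C, hC⟩ := (isCompact_closedBall (0 : ℂ) 1).exists_bound_of_continuousOn
    Q.continuous.continuousOn
  exact ⟨max C 1, by positivity, fun x hx => (hC x (by simpa using hx)).trans (le_max_left _ _)⟩

/-- The algebra of the sequences `P(x)`, for the polynomials `P` without constant term. -/
def polynomialAlgebra (x : ℕ → ℂ) : NonUnitalSubalgebra ℂ C₀(ℕ, ℂ) where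
  carrier := {y | ∃ P : Polynomial ℂ, P.eval 0 = 0 ∧ ∀ q, y q = P.eval (x q)}
  add_mem' := by
    rintro _ _ ⟨P, hP, hy⟩ ⟨Q, hQ, hz⟩
    exact ⟨P + Q, by simp [hP, hQ], fun q => by simp [hy, hz]⟩
  zero_mem' := ⟨0, by simp, fun q => by simp⟩
  mul_mem' := by
    rintro _ _ ⟨P, hP, hy⟩ ⟨Q, hQ, hz⟩
    exact ⟨P * Q, by simp [hP], fun q => by simp [hy, hz]⟩
  smul_mem' := by
    rintro c _ ⟨P, hP, hy⟩
    exact ⟨c • P, by simp [hP], fun q => by simp [hy]⟩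

/-! ### Frequent hypercyclicity -/

lemma norm_harmonicShift_pow_apply (y : C₀(ℕ, ℂ)) (n s : ℕ) :
    ‖(harmonicShift ^ n) y s‖ = ((n + s : ℕ) + 1) * ‖y (n + s)‖ / (s + 1) := by
  rw [harmonicShift_pow_apply, norm_mul, norm_div,
    show ‖((n + s : ℕ) : ℂ) + 1‖ = (n + s : ℕ) + 1 by
      exact_mod_cast Complex.norm_natCast (n + s + 1),
    show ‖(s : ℂ) + 1‖ = s + 1 by exact_mod_cast Complex.norm_natCast (s + 1), div_mul_eq_mul_div]

lemma isFrequentlyHypercyclicVector_of_eval {P : Polynomial ℂ} (hP : P ≠ 0) (h0 : P.eval 0 = 0)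
    {y : C₀(ℕ, ℂ)} (hy : ∀ q, y q = P.eval (generator q)) :
    IsFrequentlyHypercyclicVector harmonicShift y := by
  intro U hU hne
  obtain ⟨u, hu⟩ := hne
  obtain ⟨ε, hε, hball⟩ := Metric.isOpen_iff.1 hU u hu
  obtain ⟨m, Q, hm, hQ0, rfl⟩ := exists_eq_X_pow_mul hP h0
  obtain ⟨C, hC, hQ⟩ := exists_norm_eval_le Q
  set a := Q.eval 0 with ha
  have ha0 : 0 < ‖a‖ := norm_pos_iff.2 hQ0
  have hyq : ∀ q, y q = generator q ^ m * Q.eval (generator q) := fun q => by simp [hy]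
  have hyn : ∀ q, ‖y q‖ ≤ ‖generator q‖ ^ m * C := fun q => by
    rw [hyq, norm_mul, norm_pow]
    gcongr
    exact hQ _ (norm_generator_le_one q)
  have hus : ∀ᶠ s in atTop, ‖u s‖ < ε / 4 := by
    have := (tendsto_apply_atTop u).norm
    rw [norm_zero] at this
    exact this.eventually_lt_const (by positivity)
  obtain ⟨p, hp⟩ := eventually_atTop.1 hus
  -- The word compensates for the factor `a` and for the division by `s + 1` in the iterate.
  obtain ⟨l, hlp, hl⟩ := exists_codedSeq_close (fun k => (k + 1) * u k / a) p
    (δ := ε / 4 / ‖a‖) (by positivity)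
  obtain ⟨M, hM0, hM⟩ := exists_norm_codedSeq_le l
  have hz : ∀ s : ℕ, ‖a * codedSeq l s / (s + 1) - u s‖ ≤ ε / 4 := fun s => by
    rcases lt_or_ge s p with hs | hs
    · have h1 : (s : ℂ) + 1 ≠ 0 := Nat.cast_add_one_ne_zero s
      have h2 : a * codedSeq l s / (s + 1) - u s
          = a * (codedSeq l s - (s + 1) * u s / a) / (s + 1) := by
        field_simp
      have h3 := (lt_div_iff₀ ha0).1 (hl s hs)
      rw [h2, norm_div, norm_mul,
        show ‖(s : ℂ) + 1‖ = s + 1 by exact_mod_cast Complex.norm_natCast (s + 1)]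
      refine (div_le_self (by positivity) (by linarith [s.cast_nonneg (α := ℝ)])).trans ?_
      linarith
    · rw [codedSeq_of_length_le (hlp.trans_le hs)]
      simpa using (hp s hs).le
  -- One period contains the whole word, and the later repetitions, divided by `s + 1 > N`, stay
  -- below `ε / 4`.
  obtain ⟨N, hNp, hN⟩ : ∃ N : ℕ, p + 1 ≤ N ∧ M * C / (ε / 4) ≤ N :=
    (exists_nat_ge (M * C / (ε / 4))).elim fun N hN =>
      ⟨max (p + 1) N, le_max_left _ _, hN.trans (by exact_mod_cast le_max_right _ _)⟩
  have hN0 : 0 < N := by omega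
  have hQt : ∀ᶠ q in atTop, ‖Q.eval (generator q) - a‖ < ε / 4 / (M + 1) := by
    have := (Q.continuous.tendsto 0).comp tendsto_generator
    filter_upwards [Metric.tendsto_nhds.1 this _ (show 0 < ε / 4 / (M + 1) by positivity)] with q h
    simpa [dist_eq_norm] using h
  have hct : ∀ᶠ q in atTop, cutoff q < ε / 4 / (2 * C) :=
    tendsto_cutoff.eventually_lt_const (by positivity)
  obtain ⟨J, hJ⟩ := eventually_atTop.1 ((hQt.and hct).and (eventually_div_le_cutoff_pow hM0 m))
  refine lowerDensity_pos_of_blocks (i := Encodable.encode (m, l, N)) (J := J) hN0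
    fun j n hj hji hNn hn1 hn2 => hball ?_
  have hd : blockData j = (m, l, N) := by
    rw [blockData, hji, Denumerable.ofNat_encode]
  have hJq : ∀ q ≥ n, J ≤ q := fun q hq =>
    ((hj.trans (Nat.lt_pow_self (by norm_num : 1 < 4)).le).trans hn1).trans hq
  rw [Metric.mem_ball, dist_eq_norm]
  refine (norm_le_of_forall_apply_le (c := ε / 2) (by positivity) fun s => ?_).trans_lt
    (half_lt_self hε)
  rw [ZeroAtInftyContinuousMap.sub_apply]
  obtain ⟨⟨hQq, hcq⟩, hMq⟩ := hJ (n + s) (hJq _ (Nat.le_add_right n s))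
  have hs0 : (0 : ℝ) < s + 1 := by positivity
  rcases lt_or_ge s N with hsN | hsN
  · have hmod : (n + s) % N = s := by
      rw [Nat.add_mod, Nat.mod_eq_zero_of_dvd hNn, zero_add, Nat.mod_mod, Nat.mod_eq_of_lt hsN]
    have hpow := generator_pow_eq hd hm (q := n + s) (by omega) (by rw [pow_succ]; omega)
      (by rw [hmod]; exact (div_le_div_of_nonneg_right (hM s) (by positivity)).trans hMq)
    rw [hmod] at hpow
    have heq : (harmonicShift ^ n) y s - u s
        = codedSeq l s * (Q.eval (generator (n + s)) - a) / (s + 1)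
          + (a * codedSeq l s / (s + 1) - u s) := by
      rw [harmonicShift_pow_apply, hyq, div_mul_eq_mul_div, ← mul_assoc, hpow]
      ring
    rw [heq]
    refine (norm_add_le _ _).trans ?_
    have h1 : ‖codedSeq l s * (Q.eval (generator (n + s)) - a) / (s + 1)‖ ≤ ε / 4 := by
      rw [norm_div, norm_mul,
        show ‖(s : ℂ) + 1‖ = s + 1 by exact_mod_cast Complex.norm_natCast (s + 1)]
      refine (div_le_self (by positivity) (by linarith [s.cast_nonneg (α := ℝ)])).trans ?_
      calc _ ≤ (M + 1) * (ε / 4 / (M + 1)) := by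
            gcongr
            linarith [hM s]
        _ = ε / 4 := by field_simp
    linarith [hz s]
  · have hus := hp s (by omega)
    refine (norm_sub_le _ _).trans ?_
    suffices ‖(harmonicShift ^ n) y s‖ ≤ ε / 4 by linarith
    rw [norm_harmonicShift_pow_apply, div_le_iff₀ hs0]
    -- Within the block, the pattern bound is divided by a large `s + 1`. Beyond it, `n ≤ 2 * 4 ^ j`
    -- gives `n ≤ s`, so the amplification is at most `2` and the smallness of `y` suffices.
    rcases lt_or_ge (n + s) (4 ^ (j + 1)) with hq | hq
    · have h1 := norm_generator_pow_le hd hm (q := n + s) (by omega) hq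
      have h2 : M * C ≤ N * (ε / 4) := (div_le_iff₀ (by positivity)).1 hN
      have h3 : (N : ℝ) ≤ s := by exact_mod_cast hsN
      calc ((n + s : ℕ) + 1 : ℝ) * ‖y (n + s)‖
          ≤ ((n + s : ℕ) + 1) * (‖generator (n + s)‖ ^ m * C) := by gcongr; exact hyn _
        _ = ((n + s : ℕ) + 1) * ‖generator (n + s)‖ ^ m * C := by ring
        _ ≤ M * C := by gcongr; exact h1.trans (hM _)
        _ ≤ ε / 4 * (s + 1) := by nlinarith
    · have h1 : n ≤ s := by rw [pow_succ] at hq; omega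
      have h2 : (((n + s : ℕ) : ℝ) + 1) ≤ 2 * (s + 1) := by
        have : n + s + 1 ≤ 2 * (s + 1) := by omega
        exact_mod_cast this
      have h3 : ‖y (n + s)‖ ≤ ε / 4 / (2 * C) * C := by
        refine (hyn _).trans ?_
        gcongr
        exact (pow_le_of_le_one (norm_nonneg _) (norm_generator_le_one _) hm).trans
          ((norm_generator_le _).trans hcq.le)
      calc (((n + s : ℕ) : ℝ) + 1) * ‖y (n + s)‖
          ≤ (2 * (s + 1)) * (ε / 4 / (2 * C) * C) := by gcongr
        _ = ε / 4 * (s + 1) := by field_simp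

/-- The orbit of `0` misses the open set of nonzero sequences. This yields that the generator is
nonzero without computing any coordinate. -/
lemma not_isFrequentlyHypercyclicVector_zero :
    ¬ IsFrequentlyHypercyclicVector harmonicShift (0 : C₀(ℕ, ℂ)) := by
  intro h
  have hne : ({0}ᶜ : Set C₀(ℕ, ℂ)).Nonempty := by
    refine ⟨zeroAtInftyOfTendsto (fun n => (cutoff n : ℂ)) ?_, fun h => ?_⟩
    · exact_mod_cast (Complex.continuous_ofReal.tendsto 0).comp tendsto_cutoff
    · have := DFunLike.congr_fun h 0
      simp only [zeroAtInftyOfTendsto_apply, ZeroAtInftyContinuousMap.zero_apply,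
        Complex.ofReal_eq_zero] at this
      exact (cutoff_pos 0).ne' this
  have := h _ isOpen_compl_singleton hne
  simp [lowerDensity] at this

theorem theorem1p6 :
    ∃ w : ℕ → ℂ, (∀ n : ℕ, 1 ≤ n → w n ≠ 0) ∧
      ∃ T : C₀(ℕ, ℂ) →L[ℂ] C₀(ℕ, ℂ),
        IsWeightedBackwardShift w T ∧ SupportsFrequentlyHypercyclicAlgebra T := by
  refine ⟨harmonicWeight, fun n hn => div_ne_zero (Nat.cast_add_one_ne_zero n)
    (Nat.cast_ne_zero.2 (by omega)), harmonicShift, isWeightedBackwardShift_harmonicShift,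
    polynomialAlgebra generator,
    ⟨zeroAtInftyOfTendsto generator tendsto_generator, ⟨Polynomial.X, by simp, by simp⟩,
      fun h => not_isFrequentlyHypercyclicVector_zero (h ▸ ?_)⟩, ?_⟩
  · exact isFrequentlyHypercyclicVector_of_eval Polynomial.X_ne_zero (by simp) (by simp)
  · rintro y ⟨P, hP0, hy⟩ hy0
    refine isFrequentlyHypercyclicVector_of_eval (fun hP => hy0 ?_) hP0 hy
    ext q
    simp [hy, hP]
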